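/- Let $K$ be an algebraically closed field and let $X$ be a smooth surface over $K$, i.e. an integral separated scheme of finite type over $K$ that is smooth of relative dimension $2$ (not necessarily projective). Let $f\colon X\dashrightarrow X$ be a rational map over $K$, and let $I(f)$ be its indeterminacy set, the complement of the largest open subset on which $f$ is defined. For a closed point $p$ put $f^0(p)=p$ and $f^{n+1}(p)=f(f^n(p))$ as long as $f^n(p)\notin I(f)$. A *curve* on $X$ is a nonempty finite union of irreducible closed subsets of dimension $1$. For a closed set $C\subseteq X$ let $f(C):=\overline{f(C\setminus I(f))}$, and let $f^a(C)$ be the result of applying this operation $a$ times. The curve $C$ is *periodic* if $f^a(C)=C$ for some integer $a>0$. The point $p$ is *preperiodic* if $f^m(p)=f^n(p)$ for some $0\le m<n$. An *arithmetic progression* is a set $\{an+b\mid n\in\mathbb N\}$ with $a,b\in\mathbb N=\{0,1,2,\dots\}$, where $a=0$ is allowed. Then the following statements are equivalent. 1. The pair $(X,f)$ satisfies the DML property: for every curve $C$ on $X$ and every closed point $p\in X$ such that $f^n(p)\notin I(f)$ for all $n\ge 0$, the set $\{n\in\mathbb N\mid f^n(p)\in C\}$ is a union of at most finitely many arithmetic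 progressions. 2. For every irreducible curve $C$ on $X$ and every closed point $p\in X$ such that $f^n(p)\notin I(f)$ for all $n\ge 0$ and the set $\{n\in\mathbb N\mid f^n(p)\in C\}$ is infinite, $p$ is preperiodic or $C$ is periodic. -/

import Mathlib

universe u

open AlgebraicGeometry

namespace SurfaceDynamics

variable {X : Scheme.{u}}

/-- The indeterminacy set `I(f)`: the complement of the largest open subset on which the rational
map `f` is defined. -/
def indeterminacy (f : X.RationalMap X) : Set X :=
  (f.domain : Set X)ᶜ

/-- The action of a rational self-map on points, as a partial function: `f(x)` is defined exactly
when `x` lies outside `I(f)`. -/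
noncomputable def pointMap [IsReduced X] [X.IsSeparated] (f : X.RationalMap X) : PFun X X :=
  fun x => ⟨x ∈ f.toPartialMap.domain, fun hx => f.toPartialMap.hom ⟨x, hx⟩⟩

/-- The iterates on points: `f^0(x) = x` and `f^(n+1)(x) = f(f^n(x))`. The value `f^n(x)` is
defined exactly when none of `x, f(x), …, f^(n-1)(x)` lies in `I(f)`. -/
noncomputable def iter [IsReduced X] [X.IsSeparated] (f : X.RationalMap X) : ℕ → PFun X X
  | 0 => PFun.id X
  | n + 1 => (pointMap f).comp (iter f n)

/-- The forward orbit of `p` avoids the indeterminacy set: `f^n(p) ∉ I(f)` for all `n ≥ 0`. -/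
def OrbitAvoids [IsReduced X] [X.IsSeparated] (f : X.RationalMap X) (p : X) : Prop :=
  ∀ n : ℕ, ∃ q ∈ iter f n p, q ∉ indeterminacy f

/-- The set of times `{n ∈ ℕ | f^n(p) ∈ C}`. -/
def returnSet [IsReduced X] [X.IsSeparated] (f : X.RationalMap X) (p : X) (C : Set X) : Set ℕ :=
  {n | ∃ q ∈ iter f n p, q ∈ C}

/-- `p` is preperiodic: `f^m(p) = f^n(p)` for some `m < n`. -/
def IsPreperiodic [IsReduced X] [X.IsSeparated] (f : X.RationalMap X) (p : X) : Prop :=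
  ∃ m n : ℕ, m < n ∧ ∃ q, q ∈ iter f m p ∧ q ∈ iter f n p

/-- The strict transform `f(C)`, the closure of `f(C \ I(f))`. -/
def strictTransform [IsReduced X] [X.IsSeparated] (f : X.RationalMap X) (C : Set X) : Set X :=
  closure ((pointMap f).image (C \ indeterminacy f))

/-- `C` is periodic: `f^a(C) = C` for some `a > 0`, where `f^a(C)` is the `a`-fold iterated strict
transform. -/
def IsPeriodicCurve [IsReduced X] [X.IsSeparated] (f : X.RationalMap X) (C : Set X) : Prop :=
  ∃ a : ℕ, 0 < a ∧ (strictTransform f)^[a] C = C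

/-- An irreducible curve: an irreducible closed subset of dimension one. -/
structure IsIrreducibleCurve (C : Set X) : Prop where
  isClosed : IsClosed C
  isIrreducible : IsIrreducible C
  dim_eq_one : topologicalKrullDim C = 1

/-- A curve, possibly reducible: a nonempty finite union of irreducible curves. -/
def IsCurve (C : Set X) : Prop :=
  ∃ T : Set (Set X), T.Finite ∧ T.Nonempty ∧ (∀ Z ∈ T, IsIrreducibleCurve Z) ∧ C = ⋃₀ T

/-- A union of at most finitely many arithmetic progressions `{a n + b | n ∈ ℕ}` with
`a, b ∈ ℕ`, where `a = 0` is allowed. -/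
def IsFiniteUnionOfAP (S : Set ℕ) : Prop :=
  ∃ T : Finset (ℕ × ℕ), S = {m | ∃ ab ∈ T, ∃ n : ℕ, m = ab.1 * n + ab.2}

/-- The DML property of the pair `(X, f)`. -/
def HasDML [IsReduced X] [X.IsSeparated] (f : X.RationalMap X) : Prop :=
  ∀ C : Set X, IsCurve C → ∀ p : X, IsClosed {p} → OrbitAvoids f p →
    IsFiniteUnionOfAP (returnSet f p C)

end SurfaceDynamics

namespace SurfaceDynamics

section ArithmeticProgressions

/-! Only two geometric facts matter: `X` is Noetherian, and an infinite subset of an irreducible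
curve is dense in it (`IsIrreducibleCurve.closure_eq_of_infinite`). Given DML, an infinite return
set contains a progression of step `a > 0`. If `p` is not preperiodic, the orbit points along it and
along its shift by `a` are both dense in `C`. Strict transforms commute with closures of sets
avoiding `I(f)` (`strictTransform_closure`), so `f^a(C) = C`. Conversely, periodicity of `C` or
preperiodicity of `p` makes the return set eventually stable under adding a period, and
`IsFiniteUnionOfAP.of_add_mem` applies. Reducible curves are handled component by component. -/

lemma IsFiniteUnionOfAP.empty : IsFiniteUnionOfAP ∅ :=
  ⟨∅, by simp⟩

lemma isFiniteUnionOfAP_progression (a b : ℕ) :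
    IsFiniteUnionOfAP {m | ∃ n : ℕ, m = a * n + b} :=
  ⟨{(a, b)}, by simp⟩

lemma IsFiniteUnionOfAP.union {S T : Set ℕ} (hS : IsFiniteUnionOfAP S)
    (hT : IsFiniteUnionOfAP T) : IsFiniteUnionOfAP (S ∪ T) := by
  classical
  obtain ⟨s, rfl⟩ := hS
  obtain ⟨t, rfl⟩ := hT
  refine ⟨s ∪ t, Set.ext fun m => ?_⟩
  simp only [Set.mem_union, Set.mem_ofPred_eq, Finset.mem_union, or_and_right, exists_or]

lemma IsFiniteUnionOfAP.biUnion {ι : Type*} {I : Set ι} (hI : I.Finite) {S : ι → Set ℕ}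
    (h : ∀ i ∈ I, IsFiniteUnionOfAP (S i)) : IsFiniteUnionOfAP (⋃ i ∈ I, S i) := by
  induction I, hI using Set.Finite.induction_on with
  | empty => simpa using IsFiniteUnionOfAP.empty
  | insert _ _ ih =>
    rw [Set.biUnion_insert]
    exact (h _ (Set.mem_insert _ _)).union (ih fun i hi => h i (Set.mem_insert_of_mem _ hi))

lemma IsFiniteUnionOfAP.of_finite {S : Set ℕ} (hS : S.Finite) : IsFiniteUnionOfAP S := by
  rw [← Set.biUnion_of_singleton S]
  refine IsFiniteUnionOfAP.biUnion hS fun b _ => ?_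
  simpa using isFiniteUnionOfAP_progression 0 b

/-- A set of natural numbers that is eventually stable under adding some `a > 0` is a finite union
of arithmetic progressions. -/
lemma IsFiniteUnionOfAP.of_add_mem {S : Set ℕ} {a N : ℕ} (ha : 0 < a)
    (h : ∀ n ∈ S, N ≤ n → n + a ∈ S) : IsFiniteUnionOfAP S := by
  classical
  have hS : S = (S ∩ Set.Iio N) ∪ ⋃ r ∈ Set.Iio a, {n | n ∈ S ∧ N ≤ n ∧ n % a = r} := by
    ext n
    simp only [Set.mem_union, Set.mem_inter_iff, Set.mem_Iio, Set.mem_iUnion, Set.mem_ofPred_eq,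
      exists_prop]
    constructor
    · intro hn
      rcases lt_or_ge n N with hN | hN
      · exact Or.inl ⟨hn, hN⟩
      · exact Or.inr ⟨n % a, Nat.mod_lt _ ha, hn, hN, rfl⟩
    · rintro (⟨hn, -⟩ | ⟨-, -, hn, -⟩) <;> exact hn
  rw [hS]
  refine (of_finite ((Set.finite_Iio N).inter_of_right S)).union
    (biUnion (Set.finite_Iio a) fun r _ => ?_)
  by_cases hr : ∃ n, n ∈ S ∧ N ≤ n ∧ n % a = r
  -- The least element past `N` of each residue class generates the rest of that class in steps of
  -- `a`.
  · obtain ⟨hm, hNm, hmr⟩ := Nat.find_spec hr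
    convert isFiniteUnionOfAP_progression a (Nat.find hr) using 1
    ext n
    simp only [Set.mem_ofPred_eq]
    constructor
    · intro hn
      have hle : Nat.find hr ≤ n := Nat.find_min' hr hn
      have hdvd : a ∣ n - Nat.find hr := (Nat.modEq_iff_dvd' hle).1 (hmr.trans hn.2.2.symm)
      obtain ⟨k, hk⟩ := hdvd
      exact ⟨k, by omega⟩
    · rintro ⟨k, rfl⟩
      induction k with
      | zero => exact (Nat.zero_add (Nat.find hr)).symm ▸ ⟨hm, hNm, hmr⟩
      | succ k ih =>
        obtain ⟨h₁, h₂, h₃⟩ := ih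
        have he : a * (k + 1) + Nat.find hr = a * k + Nat.find hr + a := by ring
        rw [he]
        exact ⟨h _ h₁ h₂, by omega, by rw [Nat.add_mod_right, h₃]⟩
  · convert IsFiniteUnionOfAP.empty
    exact Set.eq_empty_of_forall_notMem fun n hn => hr ⟨n, hn⟩

lemma IsFiniteUnionOfAP.exists_progression_subset {S : Set ℕ} (hS : IsFiniteUnionOfAP S)
    (hinf : S.Infinite) : ∃ a b : ℕ, 0 < a ∧ ∀ n, a * n + b ∈ S := by
  obtain ⟨T, rfl⟩ := hS
  by_contra! hne
  refine hinf ((T.finite_toSet.image Prod.snd).subset ?_)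
  rintro m ⟨⟨a, b⟩, hab, n, rfl⟩
  have ha : a = 0 := by
    by_contra ha
    obtain ⟨k, hk⟩ := hne a b (Nat.pos_of_ne_zero ha)
    exact hk ⟨(a, b), hab, k, rfl⟩
  exact ⟨(a, b), hab, by simp [ha]⟩

end ArithmeticProgressions

section Topology

open TopologicalSpace

lemma dense_of_infinite_of_krullDim_le_one {Y : Type*} [TopologicalSpace Y] [NoetherianSpace Y]
    [T0Space Y] [IrreducibleSpace Y] (hdim : topologicalKrullDim Y ≤ 1) {S : Set Y}
    (hS : S.Infinite) : Dense S := by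
  obtain ⟨T, hT, hTc, hTi, hST⟩ :=
    NoetherianSpace.exists_finite_set_isClosed_irreducible (isClosed_closure (s := S))
  obtain ⟨W, hW, hWinf⟩ : ∃ W ∈ T, W.Infinite := by
    by_contra! hfin
    refine hS (Set.Finite.subset ?_ subset_closure)
    rw [hST]
    exact hT.sUnion fun W hW => hfin W hW
  let W' : IrreducibleCloseds Y := ⟨W, hTi W hW, hTc W hW⟩
  rcases Order.krullDim_le_one_iff.1 hdim W' with hmin | hmax
  -- A minimal irreducible closed set is the closure of each of its points, so T0 makes it a single
  -- point, against `hWinf`.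
  · refine (hWinf (Set.Subsingleton.finite fun x hx y hy => ?_)).elim
    have key : ∀ z ∈ W, closure {z} = W := fun z hz => by
      have hz' : closure {z} ⊆ W := closure_minimal (Set.singleton_subset_iff.2 hz) (hTc W hW)
      exact hz'.antisymm
        (@hmin ⟨closure {z}, isIrreducible_singleton.closure, isClosed_closure⟩ hz')
    exact (inseparable_iff_closure_eq.2 ((key x hx).trans (key y hy).symm)).eq
  · have htop : Set.univ ⊆ W :=
      @hmax ⟨Set.univ, IrreducibleSpace.isIrreducible_univ Y, isClosed_univ⟩ (Set.subset_univ W)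
    rw [dense_iff_closure_eq, hST]
    exact Set.eq_univ_of_univ_subset (htop.trans (Set.subset_sUnion_of_mem hW))

lemma IsIrreducibleCurve.closure_eq_of_infinite {X : Scheme.{u}} [NoetherianSpace X] {C S : Set X}
    (hC : IsIrreducibleCurve C) (hSC : S ⊆ C) (hS : S.Infinite) : closure S = C := by
  have : IrreducibleSpace C := isIrreducible_iff_irreducibleSpace.1 hC.isIrreducible
  have : NoetherianSpace C := Topology.IsInducing.subtypeVal.noetherianSpace
  refine (closure_minimal hSC hC.isClosed).antisymm ?_
  have hd : Dense ((↑) ⁻¹' S : Set C) := by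
    refine dense_of_infinite_of_krullDim_le_one hC.dim_eq_one.le fun hfin => hS ?_
    simpa [Subtype.image_preimage_coe, Set.inter_eq_right.2 hSC] using hfin.image ((↑) : C → X)
  exact (Subtype.dense_iff.1 hd).trans (closure_mono (Set.image_preimage_subset _ _))

lemma IsIrreducibleCurve.isCurve {X : Scheme.{u}} {C : Set X} (hC : IsIrreducibleCurve C) : IsCurve C :=
  ⟨{C}, Set.finite_singleton C, Set.singleton_nonempty C, by simpa using hC, by simp⟩

end Topology

section Dynamics

variable {X : Scheme.{u}} [IsReduced X] [X.IsSeparated] {f : X.RationalMap X}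

/-- Continuity of `f` on its domain: a neighbourhood of `f(x)` pulls back to an open neighbourhood
of `x`, which meets `S`. -/
lemma strictTransform_closure {S : Set X} (hS : ∀ x ∈ S, x ∉ indeterminacy f) :
    strictTransform f (closure S) = closure ((pointMap f).image S) := by
  refine (closure_minimal ?_ isClosed_closure).antisymm
    (closure_mono (PFun.image_mono _ fun x hx => ⟨subset_closure hx, hS x hx⟩))
  rintro _ ⟨x, ⟨hx, -⟩, hxd, rfl⟩
  refine mem_closure_iff.2 fun V hV hxV => ?_
  let W : f.toPartialMap.domain.toScheme.Opens := f.toPartialMap.hom ⁻¹ᵁ ⟨V, hV⟩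
  obtain ⟨s, ⟨⟨s', hsd⟩, hsV, rfl⟩, hs⟩ :=
    mem_closure_iff.1 hx (Subtype.val '' (W : Set f.toPartialMap.domain))
      (f.toPartialMap.domain.isOpen.isOpenMap_subtype_val _ W.isOpen) ⟨⟨x, hxd⟩, hxV, rfl⟩
  exact ⟨_, hsV, s', hs, hsd, rfl⟩

variable {p : X}

lemma OrbitAvoids.exists_orbit (h : OrbitAvoids f p) :
    ∃ q : ℕ → X, (∀ n, q n ∈ iter f n p) ∧ (∀ n, q n ∉ indeterminacy f) ∧
      ∀ n, q (n + 1) ∈ pointMap f (q n) := by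
  choose q hq hqI using h
  refine ⟨q, hq, hqI, fun n => ?_⟩
  obtain ⟨y, hy, hy'⟩ := Part.mem_bind_iff.1 (hq (n + 1))
  rwa [Part.mem_unique (hq n) hy]

lemma mem_returnSet_iff {q : ℕ → X} (hq : ∀ n, q n ∈ iter f n p) {C : Set X} {n : ℕ} :
    n ∈ returnSet f p C ↔ q n ∈ C :=
  ⟨fun ⟨_, hy, hyC⟩ => Part.mem_unique (hq n) hy ▸ hyC, fun h => ⟨q n, hq n, h⟩⟩

lemma injective_orbit_of_not_isPreperiodic {q : ℕ → X} (hq : ∀ n, q n ∈ iter f n p)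
    (hp : ¬ IsPreperiodic f p) : Function.Injective q := by
  intro m n h
  by_contra hmn
  rcases lt_or_gt_of_ne hmn with hlt | hlt
  · exact hp ⟨m, n, hlt, q m, hq m, h ▸ hq n⟩
  · exact hp ⟨n, m, hlt, q n, hq n, h ▸ hq m⟩

lemma iterate_strictTransform_closure_orbit {q : ℕ → X} (hqI : ∀ n, q n ∉ indeterminacy f)
    (hstep : ∀ n, q (n + 1) ∈ pointMap f (q n)) (T : Set ℕ) (k : ℕ) :
    (strictTransform f)^[k] (closure (q '' T)) = closure ((fun n => q (n + k)) '' T) := by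
  induction k with
  | zero => rfl
  | succ k ih =>
    rw [Function.iterate_succ_apply', ih, strictTransform_closure]
    · congr 1
      ext y
      simp only [PFun.mem_image, Set.exists_mem_image]
      exact ⟨fun ⟨n, hn, hy⟩ => ⟨n, hn, Part.mem_unique (hstep (n + k)) hy⟩,
        fun ⟨n, hn, hy⟩ => ⟨n, hn, hy ▸ hstep (n + k)⟩⟩
    · rintro _ ⟨n, -, rfl⟩
      exact hqI _

lemma orbit_mem_iterate_strictTransform {q : ℕ → X} (hqI : ∀ n, q n ∉ indeterminacy f)
    (hstep : ∀ n, q (n + 1) ∈ pointMap f (q n)) {C : Set X} {n : ℕ} (hn : q n ∈ C) (k : ℕ) :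
    q (n + k) ∈ (strictTransform f)^[k] C := by
  induction k with
  | zero => exact hn
  | succ k ih =>
    rw [Function.iterate_succ_apply']
    exact subset_closure ⟨q (n + k), ⟨ih, hqI _⟩, hstep _⟩

lemma isPeriodicCurve_of_progression_subset [TopologicalSpace.NoetherianSpace X] {C : Set X}
    (hC : IsIrreducibleCurve C) (hp : OrbitAvoids f p) (hpre : ¬ IsPreperiodic f p) {a b : ℕ}
    (ha : 0 < a) (hab : ∀ n, a * n + b ∈ returnSet f p C) : IsPeriodicCurve f C := by
  obtain ⟨q, hq, hqI, hstep⟩ := hp.exists_orbit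
  have hinj := injective_orbit_of_not_isPreperiodic hq hpre
  have hmem : ∀ n, q (a * n + b) ∈ C := fun n => (mem_returnSet_iff hq).1 (hab n)
  have hprog : Function.Injective fun n => a * n + b := fun m n h =>
    Nat.eq_of_mul_eq_mul_left ha (Nat.add_right_cancel h)
  have hT : (Set.range fun n => a * n + b).Infinite := Set.infinite_range_of_injective hprog
  have h₀ : closure (q '' Set.range fun n => a * n + b) = C := by
    refine hC.closure_eq_of_infinite ?_ (hT.image hinj.injOn)
    rintro _ ⟨_, ⟨n, rfl⟩, rfl⟩
    exact hmem n
  refine ⟨a, ha, ?_⟩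
  -- The left side becomes the closure of the progression shifted by `a`, again an infinite subset
  -- of `C`.
  conv_lhs => rw [← h₀, iterate_strictTransform_closure_orbit hqI hstep]
  refine hC.closure_eq_of_infinite ?_
    (hT.image fun m _ n _ h => Nat.add_right_cancel (hinj h))
  rintro _ ⟨_, ⟨n, rfl⟩, rfl⟩
  have h := hmem (n + 1)
  rwa [show a * (n + 1) + b = a * n + b + a by ring] at h

lemma isFiniteUnionOfAP_returnSet_of_isPeriodicCurve {C : Set X} (hp : OrbitAvoids f p)
    (hC : IsPeriodicCurve f C) : IsFiniteUnionOfAP (returnSet f p C) := by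
  obtain ⟨q, hq, hqI, hstep⟩ := hp.exists_orbit
  obtain ⟨a, ha, hCa⟩ := hC
  refine IsFiniteUnionOfAP.of_add_mem (N := 0) ha fun n hn _ => ?_
  rw [mem_returnSet_iff hq] at hn ⊢
  exact hCa ▸ orbit_mem_iterate_strictTransform hqI hstep hn a

/-- From time `m` on the orbit is periodic with period `n - m`. -/
lemma isFiniteUnionOfAP_returnSet_of_isPreperiodic (hp : OrbitAvoids f p)
    (hpre : IsPreperiodic f p) (C : Set X) : IsFiniteUnionOfAP (returnSet f p C) := by
  obtain ⟨q, hq, hqI, hstep⟩ := hp.exists_orbit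
  obtain ⟨m, n, hmn, y, hym, hyn⟩ := hpre
  have hper : ∀ k, q (m + k) = q (n + k) := fun k => by
    induction k with
    | zero => exact (Part.mem_unique (hq m) hym).trans (Part.mem_unique hyn (hq n))
    | succ k ih =>
      have h := hstep (m + k)
      rw [ih] at h
      exact Part.mem_unique h (hstep (n + k))
  refine IsFiniteUnionOfAP.of_add_mem (N := m) (Nat.sub_pos_of_lt hmn) fun i hi hmi => ?_
  rw [mem_returnSet_iff hq] at hi ⊢
  obtain ⟨k, rfl⟩ := Nat.exists_eq_add_of_le hmi
  rwa [show m + k + (n - m) = n + k by omega, ← hper k]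

lemma returnSet_sUnion (T : Set (Set X)) :
    returnSet f p (⋃₀ T) = ⋃ Z ∈ T, returnSet f p Z := by
  ext n
  simp only [returnSet, Set.mem_sUnion, Set.mem_iUnion, Set.mem_ofPred_eq, exists_prop]
  exact ⟨fun ⟨y, hy, Z, hZ, hyZ⟩ => ⟨Z, hZ, y, hy, hyZ⟩,
    fun ⟨Z, hZ, y, hy, hyZ⟩ => ⟨y, hy, Z, hZ, hyZ⟩⟩

/-- On a Noetherian scheme the DML property is equivalent to: every irreducible curve that an
orbit of a closed point meets infinitely often is periodic unless the point is preperiodic. -/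
theorem hasDML_iff [TopologicalSpace.NoetherianSpace X] :
    HasDML f ↔ ∀ C : Set X, IsIrreducibleCurve C → ∀ p : X, IsClosed {p} → OrbitAvoids f p →
      (returnSet f p C).Infinite → IsPreperiodic f p ∨ IsPeriodicCurve f C := by
  constructor
  · intro h C hC p hpc hp hinf
    obtain ⟨a, b, ha, hab⟩ := (h C hC.isCurve p hpc hp).exists_progression_subset hinf
    exact or_iff_not_imp_left.2 fun hpre =>
      isPeriodicCurve_of_progression_subset hC hp hpre ha hab
  · rintro h _ ⟨T, hT, -, hTC, rfl⟩ p hpc hp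
    rw [returnSet_sUnion]
    refine IsFiniteUnionOfAP.biUnion hT fun Z hZ => ?_
    by_cases hfin : (returnSet f p Z).Finite
    · exact IsFiniteUnionOfAP.of_finite hfin
    · rcases h Z (hTC Z hZ) p hpc hp hfin with hpre | hper
      · exact isFiniteUnionOfAP_returnSet_of_isPreperiodic hp hpre Z
      · exact isFiniteUnionOfAP_returnSet_of_isPeriodicCurve hp hper

end Dynamics

lemma noetherianSpace_of_locallyOfFiniteType {X Y : Scheme.{u}} (g : X ⟶ Y)
    [LocallyOfFiniteType g] [QuasiCompact g] [IsNoetherian Y] :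
    TopologicalSpace.NoetherianSpace X := by
  have : CompactSpace X := QuasiCompact.compactSpace_of_compactSpace g
  have : IsNoetherian X := { __ := LocallyOfFiniteType.isLocallyNoetherian g }
  infer_instance

end SurfaceDynamics

theorem proposition4p2 {K : Type u} [Field K] [IsAlgClosed K]
    (X : Scheme.{u}) [X.Over (Spec (CommRingCat.of K))]
    [IsIntegral X] [X.IsSeparated] [QuasiCompact (X ↘ Spec (CommRingCat.of K))]
    [SmoothOfRelativeDimension 2 (X ↘ Spec (CommRingCat.of K))]
    (f : X.RationalMap X) [f.IsOver (Spec (CommRingCat.of K))] :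
    SurfaceDynamics.HasDML f ↔
      ∀ C : Set X, SurfaceDynamics.IsIrreducibleCurve C →
        ∀ p : X, IsClosed {p} → SurfaceDynamics.OrbitAvoids f p →
          (SurfaceDynamics.returnSet f p C).Infinite →
            SurfaceDynamics.IsPreperiodic f p ∨ SurfaceDynamics.IsPeriodicCurve f C := by
  -- Smoothness serves only to give local finiteness of type, hence Noetherianity of `X`.
  have : Smooth (X ↘ Spec (CommRingCat.of K)) := SmoothOfRelativeDimension.smooth 2 _
  have := SurfaceDynamics.noetherianSpace_of_locallyOfFiniteType (X ↘ Spec (CommRingCat.of K))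
  exact SurfaceDynamics.hasDML_iff
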